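/- Let $N$ be a smooth manifold. A quasi-Lie scheme $S(W,V)$ on $N$ consists of two nonzero finite-dimensional real vector spaces $W\subseteq V$ of smooth vector fields on $N$ such that $[W,W]\subseteq W$ and $[W,V]\subseteq V$. For an open set $J\subseteq\mathbb R$, a smooth $t$-dependent vector field $X=(X(t))_{t\in J}$ on $N$ is said to be in $S(W,V)$, written $X\in S(W,V)$, if $X(t)\in V$ for all $t\in J$; a ($t$-independent) vector field $X$ is in $S(W,V)$ if $X\in V$. Let $S(W,V)$ be a quasi-Lie scheme such that every vector field in $W$ is complete. Let $\Phi:G\times N\to N$, $\Phi_g(x)=\Phi(g,x)$, be a smooth left action of a Lie group $G$ with Lie algebra $\mathfrak g=T_eG$ which is associated with $W$, i.e. such that the map sending $a\in\mathfrak g$ to its fundamental vector field $x\mapsto \frac{d}{dt}\big|_{t=0}\Phi(\exp(ta),x)$ is a linear isomorphism of $\mathfrak g$ onto $W$. Then: 1. For every $g\in\exp(\mathfrak g)$ and every vector field $X\in S(W,V)$, the pushforward $\Phi_{g*}X$ is in $S(W,V)$. 2. For every open set $J\subseteq\mathbb R$, every smooth curve $g:J\to G$ with $g(t)\in\exp(\mathfrak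 g)$ for all $t\in J$ (not necessarily through the identity $e$), and every smooth $t$-dependent vector field $X=(X(t))_{t\in J}$ in $S(W,V)$, the transformed $t$-dependent vector field $g_\bigstar X$, given by $$(g_\bigstar X)_t=\dot g_t\circ g_t^{-1}+(g_t)_*(X(t)),\qquad g_t=\Phi_{g(t)},\quad t\in J,$$ where $(\dot g_t\circ g_t^{-1})(x)=\frac{d}{ds}\big|_{s=t}\,g_s(g_t^{-1}(x))$, is smooth and is in $S(W,V)$. -/

import Mathlib

open scoped Manifold ContDiff

noncomputable section

/-- A vector field on a manifold `N`, i.e. a (not necessarily smooth) section of its tangent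
bundle. -/
abbrev VField {E H : Type*} [NormedAddCommGroup E] [NormedSpace ℝ E] [TopologicalSpace H]
    (I : ModelWithCorners ℝ E H) (N : Type*) [TopologicalSpace N] [ChartedSpace H N] : Type _ :=
  (x : N) → TangentSpace I x

/-- The vector field `X` is smooth. -/
def IsSmoothVField {E H N : Type*} [NormedAddCommGroup E] [NormedSpace ℝ E] [TopologicalSpace H]
    {I : ModelWithCorners ℝ E H} [TopologicalSpace N] [ChartedSpace H N] [IsManifold I ∞ N]
    (X : VField I N) : Prop :=
  ContMDiff I I.tangent ∞ (fun x : N => (⟨x, X x⟩ : TangentBundle I N))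

/-- The vector field `X` is complete: through each point there is an integral curve of `X` that is
defined on the whole real line. -/
def IsCompleteVField {E H N : Type*} [NormedAddCommGroup E] [NormedSpace ℝ E] [TopologicalSpace H]
    {I : ModelWithCorners ℝ E H} [TopologicalSpace N] [ChartedSpace H N]
    (X : VField I N) : Prop :=
  ∀ x : N, ∃ γ : ℝ → N, γ 0 = x ∧ IsMIntegralCurve (I := I) γ X

/-- The `t`-dependent vector field `X` is smooth, jointly in `(t, x)`, for times `t ∈ J`. -/
def IsSmoothTimeVField {E H N : Type*} [NormedAddCommGroup E] [NormedSpace ℝ E]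
    [TopologicalSpace H] {I : ModelWithCorners ℝ E H} [TopologicalSpace N] [ChartedSpace H N]
    [IsManifold I ∞ N] (J : Set ℝ) (X : ℝ → VField I N) : Prop :=
  ContMDiffOn (𝓘(ℝ, ℝ).prod I) I.tangent ∞
    (fun p : ℝ × N => (⟨p.2, X p.1 p.2⟩ : TangentBundle I N)) (J ×ˢ Set.univ)

/-- A quasi-Lie scheme `S(W, V)` on `N`: two nonzero finite-dimensional real vector spaces `W ⊆ V`
of smooth vector fields with `[W, W] ⊆ W` and `[W, V] ⊆ V`. -/
structure QuasiLieScheme {E H : Type*} [NormedAddCommGroup E] [NormedSpace ℝ E]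
    [TopologicalSpace H] (I : ModelWithCorners ℝ E H) (N : Type*) [TopologicalSpace N]
    [ChartedSpace H N] [IsManifold I ∞ N] where
  /-- The space `W`. -/
  W : Submodule ℝ (VField I N)
  /-- The space `V`. -/
  V : Submodule ℝ (VField I N)
  smooth_W : ∀ X ∈ W, IsSmoothVField X
  smooth_V : ∀ X ∈ V, IsSmoothVField X
  finiteDimensional_W : FiniteDimensional ℝ W
  finiteDimensional_V : FiniteDimensional ℝ V
  W_ne_bot : W ≠ ⊥
  V_ne_bot : V ≠ ⊥
  W_le_V : W ≤ V
  bracket_W_W : ∀ Y ∈ W, ∀ Z ∈ W, VectorField.mlieBracket I Y Z ∈ W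
  bracket_W_V : ∀ Y ∈ W, ∀ X ∈ V, VectorField.mlieBracket I Y X ∈ V

/-- `X ∈ S(W, V)` for a `t`-dependent vector field `X` with time domain `J`: `X` is smooth and
`X(t) ∈ V` for all `t ∈ J`. -/
def QuasiLieScheme.Mem {E H N : Type*} [NormedAddCommGroup E] [NormedSpace ℝ E]
    [TopologicalSpace H] {I : ModelWithCorners ℝ E H} [TopologicalSpace N] [ChartedSpace H N]
    [IsManifold I ∞ N] (S : QuasiLieScheme I N) (J : Set ℝ) (X : ℝ → VField I N) : Prop :=
  IsSmoothTimeVField J X ∧ ∀ t ∈ J, X t ∈ S.V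

/-- The pushforward `φ_* X` of the vector field `X` by a diffeomorphism `φ` of `N`:
`(φ_* X)(x) = T φ (X (φ⁻¹ x))`. -/
def pushforwardVField {E H N : Type*} [NormedAddCommGroup E] [NormedSpace ℝ E]
    [TopologicalSpace H] {I : ModelWithCorners ℝ E H} [TopologicalSpace N] [ChartedSpace H N]
    (φ : N ≃ N) (X : VField I N) : VField I N :=
  fun x => mfderiv I I φ (φ.symm x) (X (φ.symm x))

/-- The vector field `ḣ_t ∘ h_t⁻¹` of a smooth family `h` of diffeomorphisms at the time `t`:
at `x` it is the velocity at `s = t` of the curve `s ↦ h_s (h_t⁻¹ x)`. -/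
def velocityVField {E H N : Type*} [NormedAddCommGroup E] [NormedSpace ℝ E]
    [TopologicalSpace H] (I : ModelWithCorners ℝ E H) [TopologicalSpace N] [ChartedSpace H N]
    (h : ℝ → N ≃ N) (t : ℝ) : VField I N :=
  fun x => mfderiv 𝓘(ℝ, ℝ) I (fun s : ℝ => h s ((h t).symm x)) t (1 : ℝ)

/-- The transform of a `t`-dependent vector field `X` by a smooth family `h` of diffeomorphisms:
`(h_★ X)_t = ḣ_t ∘ h_t⁻¹ + (h_t)_* (X(t))`. -/
def starVField {E H N : Type*} [NormedAddCommGroup E] [NormedSpace ℝ E]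
    [TopologicalSpace H] {I : ModelWithCorners ℝ E H} [TopologicalSpace N] [ChartedSpace H N]
    (h : ℝ → N ≃ N) (X : ℝ → VField I N) : ℝ → VField I N :=
  fun t => velocityVField I h t + pushforwardVField (h t) (X t)

/-- `IsLieExp IG a g` says that `g = exp a`: `g` is the value at time `1` of the one-parameter
subgroup of `G` with initial velocity `a`. -/
def IsLieExp {EG HG G : Type*} [NormedAddCommGroup EG] [NormedSpace ℝ EG] [TopologicalSpace HG]
    (IG : ModelWithCorners ℝ EG HG) [TopologicalSpace G] [ChartedSpace HG G] [Group G]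
    (a : GroupLieAlgebra IG G) (g : G) : Prop :=
  ∃ γ : ℝ → G, ContMDiff 𝓘(ℝ, ℝ) IG ∞ γ ∧ γ 0 = 1 ∧ (∀ s t : ℝ, γ (s + t) = γ s * γ t) ∧
    mfderiv 𝓘(ℝ, ℝ) IG γ 0 (1 : ℝ) = a ∧ γ 1 = g

/-- The set `exp(𝔤)`, the image of the exponential map of the Lie group `G`. -/
def lieExpSet {EG HG : Type*} [NormedAddCommGroup EG] [NormedSpace ℝ EG] [TopologicalSpace HG]
    (IG : ModelWithCorners ℝ EG HG) (G : Type*) [TopologicalSpace G] [ChartedSpace HG G]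
    [Group G] : Set G :=
  {g | ∃ a : GroupLieAlgebra IG G, IsLieExp IG a g}

/-- The fundamental vector field of an action of `G` on `N` that corresponds to `a ∈ T_e G`: at `x`
it is the image of `a` under the differential at the identity of the orbit map `g ↦ g • x`, i.e.
the derivative of `exp(t a) • x` at `t = 0`. -/
def fundamentalVField {EG HG G E H : Type*} [NormedAddCommGroup EG] [NormedSpace ℝ EG]
    [TopologicalSpace HG] (IG : ModelWithCorners ℝ EG HG) [TopologicalSpace G]
    [ChartedSpace HG G] [Group G] [NormedAddCommGroup E] [NormedSpace ℝ E] [TopologicalSpace H]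
    (I : ModelWithCorners ℝ E H) (N : Type*) [TopologicalSpace N] [ChartedSpace H N]
    [MulAction G N] (a : GroupLieAlgebra IG G) : VField I N :=
  fun x => mfderiv IG I (fun g : G => g • x) 1 a

/-- The left action of the Lie group `G` on `N` is associated with the Lie algebra `W` of vector
fields: the map that sends `a ∈ T_e G` to its fundamental vector field is a bijection `T_e G ≃ W`
(it is automatically linear). -/
def IsAssociatedAction {EG HG E H N : Type*} [NormedAddCommGroup EG] [NormedSpace ℝ EG]
    [TopologicalSpace HG] (IG : ModelWithCorners ℝ EG HG) (G : Type*) [TopologicalSpace G]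
    [ChartedSpace HG G] [Group G] [NormedAddCommGroup E] [NormedSpace ℝ E] [TopologicalSpace H]
    {I : ModelWithCorners ℝ E H} [TopologicalSpace N] [ChartedSpace H N] [MulAction G N]
    (W : Submodule ℝ (VField I N)) : Prop :=
  Set.BijOn (fundamentalVField IG I N : GroupLieAlgebra IG G → VField I N)
    Set.univ (W : Set (VField I N))

end

/-! ### Derivative of the pushforward along a flow, and invariance of `V`. -/

section

open scoped Topology

/-! If `g = exp a`, the one-parameter group of `a` acts on `N` as a flow `ψ` whose generator `Y`
lies in `W`. Pushforward satisfies `d/dt ψ_{t*} Z = -ψ_{t*}[Y, Z]`, and `ad Y` is a linear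
endomorphism of the finite-dimensional space `V`. Solve the linear equation `c' = ad Y c` in `V`
with `c t = X`: the two derivatives of `ψ_{s*} (c s)` cancel, so this field does not depend on `s`,
and comparing `s = t` with `s = 0` gives `ψ_{t*} X = c 0 ∈ V` (`pushforward_flow_mem`). At `t = 1`
this is the first claim.

For the second claim, the pushforward term is covered by the first. The velocity term at time `t` is
the fundamental field of the velocity of `s ↦ g s * (g t)⁻¹`, a curve through the identity, hence
lies in `W ⊆ V` (`velocityVField_smul_mem`). Smoothness holds because the sum of the two terms is
the tangent map of the action applied to a smooth map into `TG × TN`. -/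

/-- The coordinate form of `d/dt ψ_{t*} X = -[Y, X]` at `t = 0`, with `c t` playing the role of
`ψ_{-t}`. In the product rule the purely spatial second derivative of `Ψ` vanishes, as `Ψ (0, ·)` is
locally the identity. By symmetry the mixed one gives `DY X`, and moving the base point of `X` gives
`-DX Y`. -/
theorem hasDerivAt_fderiv_apply_eq_neg_lieBracket {E : Type*} [NormedAddCommGroup E]
    [NormedSpace ℝ E] {Ψ : ℝ × E → E} {u₀ : E} {Y X : E → E} {c : ℝ → E}
    (hΨ : ContDiffAt ℝ 2 Ψ (0, u₀)) (hid : ∀ᶠ u in 𝓝 u₀, Ψ (0, u) = u)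
    (hY : ∀ᶠ u in 𝓝 u₀, fderiv ℝ Ψ (0, u) (1, 0) = Y u)
    (hX : DifferentiableAt ℝ X u₀) (hc₀ : c 0 = u₀) (hc : HasDerivAt c (-(Y u₀)) 0) :
    HasDerivAt (fun t => fderiv ℝ Ψ (t, c t) (0, X (c t)))
      (-(VectorField.lieBracket ℝ Y X u₀)) 0 := by
  have hsymm : IsSymmSndFDerivAt ℝ Ψ (0, u₀) := hΨ.isSymmSndFDerivAt (by simp)
  have hD : HasFDerivAt (fderiv ℝ Ψ) (fderiv ℝ (fderiv ℝ Ψ) (0, u₀)) (0, u₀) :=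
    ((hΨ.fderiv_right (m := 1) (by norm_num)).differentiableAt (by simp)).hasFDerivAt
  set D' := fderiv ℝ (fderiv ℝ Ψ) (0, u₀) with hD'
  have hΨd : ∀ᶠ u in 𝓝 u₀, DifferentiableAt ℝ Ψ (0, u) := by
    have h1 : ∀ᶠ p in 𝓝 ((0 : ℝ), u₀), ContDiffAt ℝ 2 Ψ p := hΨ.eventually (by simp)
    have h2 : Filter.Tendsto (fun u : E => ((0 : ℝ), u)) (𝓝 u₀) (𝓝 (0, u₀)) :=
      (Continuous.prodMk_right (0 : ℝ)).tendsto u₀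
    exact (h2.eventually h1).mono fun u hu => hu.differentiableAt (by simp)
  have hspace : ∀ᶠ u in 𝓝 u₀, ∀ v, fderiv ℝ Ψ (0, u) (0, v) = v := by
    filter_upwards [hΨd, hid.eventually_nhds] with u hu hidu v
    have h1 : HasFDerivAt (fun w : E => Ψ (0, w))
        ((fderiv ℝ Ψ (0, u)).comp (ContinuousLinearMap.inr ℝ ℝ E)) u :=
      HasFDerivAt.comp u hu.hasFDerivAt (hasFDerivAt_prodMk_right (0 : ℝ) u)
    have h2 : HasFDerivAt (fun w : E => Ψ (0, w)) (ContinuousLinearMap.id ℝ E) u :=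
      (hasFDerivAt_id u).congr_of_eventuallyEq hidu
    simpa using DFunLike.congr_fun (h1.unique h2) v
  have hcurve : ∀ w : ℝ × E, HasFDerivAt (fun u : E => fderiv ℝ Ψ (0, u) w)
      (((ContinuousLinearMap.apply ℝ E w).comp D').comp (ContinuousLinearMap.inr ℝ ℝ E)) u₀ := by
    intro w
    have h1 : HasFDerivAt (fun u : E => fderiv ℝ Ψ (0, u))
        (D'.comp (ContinuousLinearMap.inr ℝ ℝ E)) u₀ :=
      HasFDerivAt.comp u₀ hD (hasFDerivAt_prodMk_right (0 : ℝ) u₀)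
    exact (ContinuousLinearMap.apply ℝ E w).hasFDerivAt.comp u₀ h1
  have hzero : ∀ v w : E, D' (0, v) (0, w) = 0 := by
    intro v w
    have h2 : HasFDerivAt (fun u : E => fderiv ℝ Ψ (0, u) (0, w)) (0 : E →L[ℝ] E) u₀ :=
      (hasFDerivAt_const w u₀).congr_of_eventuallyEq (hspace.mono fun u hu => hu w)
    simpa using DFunLike.congr_fun ((hcurve (0, w)).unique h2) v
  have hYd : ∀ v : E, D' (0, v) (1, 0) = fderiv ℝ Y u₀ v := by
    intro v
    have h2 := (hcurve (1, 0)).congr_of_eventuallyEq (hY.mono fun u hu => hu.symm)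
    simp [h2.fderiv]
  have hp : HasDerivAt (fun t => (t, c t)) ((1 : ℝ), -(Y u₀)) 0 := (hasDerivAt_id 0).prodMk hc
  have hDt : HasDerivAt (fun t => fderiv ℝ Ψ (t, c t)) (D' (1, -(Y u₀))) 0 := by
    have hD0 : HasFDerivAt (fderiv ℝ Ψ) D' ((0 : ℝ), c 0) := by rw [hc₀]; exact hD
    exact HasFDerivAt.comp_hasDerivAt (0 : ℝ) hD0 hp
  have hXt : HasDerivAt (fun t => ((0 : ℝ), X (c t))) ((0 : ℝ), fderiv ℝ X u₀ (-(Y u₀))) 0 := by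
    have hX0 : HasFDerivAt X (fderiv ℝ X u₀) (c 0) := by rw [hc₀]; exact hX.hasFDerivAt
    exact (hasDerivAt_const 0 (0 : ℝ)).prodMk (hX0.comp_hasDerivAt (0 : ℝ) hc)
  refine (hDt.clm_apply hXt).congr_deriv ?_
  have e1 : ((1 : ℝ), -(Y u₀)) = (1, 0) + (0, -(Y u₀)) := by simp
  rw [hc₀, e1, map_add, add_apply, hzero, hsymm.eq, hYd, hspace.self_of_nhds,
    VectorField.lieBracket, map_neg]
  abel

theorem exists_hasDerivAt_linear {n : ℕ} (A : (Fin n → ℝ) →ₗ[ℝ] (Fin n → ℝ)) (t₀ : ℝ)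
    (v : Fin n → ℝ) :
    ∃ c : ℝ → Fin n → ℝ, c t₀ = v ∧ ∀ t, HasDerivAt c (A (c t)) t := by
  let B : (Fin n → ℝ) →L[ℝ] (Fin n → ℝ) := A.toContinuousLinearMap
  refine ⟨fun t => NormedSpace.exp ((t - t₀) • B) v, by simp, fun t => ?_⟩
  have h := (hasDerivAt_exp_smul_const' (𝕂 := ℝ) B (t - t₀)).scomp t
    ((hasDerivAt_id t).sub_const t₀)
  have h' := h.clm_apply (hasDerivAt_const t v)
  simpa using! h'

variable {E H N : Type*} [NormedAddCommGroup E] [NormedSpace ℝ E]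
    [TopologicalSpace H] {I : ModelWithCorners ℝ E H}
    [TopologicalSpace N] [ChartedSpace H N] [IsManifold I ∞ N]

theorem mfderivWithin_extChartAt_symm_mpullbackWithin (X : VField I N) (y : N) {u : E}
    (hu : u ∈ (extChartAt I y).target) :
    mfderivWithin 𝓘(ℝ, E) I (extChartAt I y).symm (Set.range I) u
      (VectorField.mpullbackWithin 𝓘(ℝ, E) I (extChartAt I y).symm X (Set.range I) u) =
      X ((extChartAt I y).symm u) := by
  rw [VectorField.mpullbackWithin_apply]
  exact (isInvertible_mfderivWithin_extChartAt_symm hu).self_apply_inverse _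

theorem hasDerivAt_extChartAt_comp {y z : N} (hz : z ∈ (extChartAt I y).source) {γ : ℝ → N}
    {t : ℝ} (ht : γ t = z) (hγ : MDifferentiableAt 𝓘(ℝ, ℝ) I γ t) :
    HasDerivAt (fun s => extChartAt I y (γ s))
      (mfderiv I 𝓘(ℝ, E) (extChartAt I y) z (mfderiv 𝓘(ℝ, ℝ) I γ t (1 : ℝ))) t := by
  subst ht
  rw [extChartAt_source] at hz
  have h := (mdifferentiableAt_extChartAt (I := I) hz).hasMFDerivAt.comp t hγ.hasMFDerivAt
  exact HasFDerivAt.hasDerivAt (𝕜 := ℝ) (F := E) h.hasFDerivAt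

variable [I.Boundaryless]

theorem hasMFDerivAt_extChartAt_symm {y : N} {u : E} (hu : u ∈ (extChartAt I y).target) :
    HasMFDerivAt 𝓘(ℝ, E) I (extChartAt I y).symm u
      (mfderivWithin 𝓘(ℝ, E) I (extChartAt I y).symm (Set.range I) u) := by
  have h := (mdifferentiableWithinAt_extChartAt_symm (I := I) hu).hasMFDerivWithinAt
  rw [I.range_eq_univ] at h ⊢
  exact hasMFDerivWithinAt_univ.1 h

variable [FiniteDimensional ℝ E]

theorem IsSmoothVField.differentiableAt_mpullbackWithin_extChartAt_symm {X : VField I N}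
    (hX : IsSmoothVField X) (y : N) :
    DifferentiableAt ℝ (fun u => (VectorField.mpullbackWithin 𝓘(ℝ, E) I (extChartAt I y).symm X
      (Set.range I) u : E)) (extChartAt I y y) := by
  have h := VectorField.contMDiffWithinAt_mpullbackWithin_extChartAt_symm (n := ∞) (m := 1)
    (s := Set.univ) (V := X) (x := y) ((hX y).contMDiffWithinAt.of_le (by norm_num))
    uniqueMDiffOn_univ (Set.mem_univ y)
    (by rw [one_add_one_eq_two]; exact ENat.LEInfty.out)
  have h2 : ContMDiffAt _ _ _ _ _ := h.contMDiffAt (by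
    simpa using extChartAt_target_mem_nhds (I := I) y)
  rw [contMDiffAt_vectorSpace_iff_contDiffAt] at h2
  exact h2.differentiableAt (by simp)

/-- All the vectors lie in the one space `T_y N`, so an ordinary derivative makes sense. In the
chart at `y`, whose differential at `y` is the identity, the claim becomes the coordinate
computation. -/
theorem hasDerivAt_pushforward_flow {ψ : ℝ → N → N}
    (hψ : ContMDiff (𝓘(ℝ, ℝ).prod I) I ∞ (fun p : ℝ × N => ψ p.1 p.2))
    (hzero : ∀ x, ψ 0 x = x) (hinv : ∀ t x, ψ t (ψ (-t) x) = x) {X Y : VField I N}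
    (hX : IsSmoothVField X)
    (hY : ∀ x, mfderiv 𝓘(ℝ, ℝ) I (fun t => ψ t x) 0 (1 : ℝ) = Y x) (y : N) :
    HasDerivAt (F := E) (fun t => mfderiv I I (ψ t) (ψ (-t) y) (X (ψ (-t) y)))
      (-(VectorField.mlieBracket I Y X y)) 0 := by
  set e := extChartAt I y with he
  let Ψ : ℝ × E → E := fun p => e (ψ p.1 (e.symm p.2))
  let c : ℝ → E := fun t => e (ψ (-t) y)
  let Xh : E → E := VectorField.mpullbackWithin 𝓘(ℝ, E) I e.symm X (Set.range I)
  let Yh : E → E := VectorField.mpullbackWithin 𝓘(ℝ, E) I e.symm Y (Set.range I)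
  have hψt : ∀ x, ContMDiff 𝓘(ℝ, ℝ) I ∞ (fun t => ψ t x) := fun x =>
    hψ.comp (contMDiff_id.prodMk contMDiff_const)
  have hψx : ∀ t, ContMDiff I I ∞ (ψ t) := fun t =>
    hψ.comp (contMDiff_const.prodMk contMDiff_id)
  have hΨ : ∀ t, ∀ u ∈ e.target, ψ t (e.symm u) ∈ e.source → ContDiffAt ℝ ∞ Ψ (t, u) := by
    intro t u hu hs
    rw [← contMDiffAt_iff_contDiffAt]
    have h1 : ContMDiffAt 𝓘(ℝ, ℝ × E) I ∞ (fun p : ℝ × E => e.symm p.2) (t, u) :=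
      ((contMDiffOn_extChartAt_symm y).contMDiffAt
        ((isOpen_extChartAt_target y).mem_nhds hu)).comp (t, u)
        (contDiff_snd.contMDiff.contMDiffAt)
    have h2 : ContMDiffAt 𝓘(ℝ, ℝ × E) I ∞ (fun p : ℝ × E => ψ p.1 (e.symm p.2)) (t, u) :=
      hψ.contMDiffAt.comp (t, u) ((contDiff_fst.contMDiff.contMDiffAt).prodMk h1)
    exact (contMDiffAt_extChartAt' (by simpa [he] using hs)).comp (t, u) h2
  have hmap : ∀ {u}, u ∈ e.target → e.symm u ∈ e.source := fun hu => e.map_target hu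
  have htime : ∀ u ∈ e.target, fderiv ℝ Ψ (0, u) (1, 0) = Yh u := by
    intro u hu
    have h1 := hasDerivAt_extChartAt_comp (y := y) (hmap hu) (hzero (e.symm u))
      ((hψt (e.symm u)).mdifferentiableAt (by simp))
    rw [hY, ← mfderivWithin_extChartAt_symm_mpullbackWithin Y y hu] at h1
    have hd : HasFDerivAt Ψ (fderiv ℝ Ψ (0, u)) ((0 : ℝ), u) :=
      ((hΨ 0 u hu (by rw [hzero]; exact hmap hu)).differentiableAt (by simp)).hasFDerivAt
    have hp : HasDerivAt (fun t : ℝ => (t, u)) ((1 : ℝ), (0 : E)) 0 :=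
      (hasDerivAt_id (0 : ℝ)).prodMk (hasDerivAt_const (0 : ℝ) u)
    have h2 : HasDerivAt (Ψ ∘ fun t : ℝ => (t, u)) (fderiv ℝ Ψ (0, u) (1, 0)) 0 :=
      HasFDerivAt.comp_hasDerivAt (0 : ℝ) hd hp
    refine (h2.unique h1).trans ?_
    exact DFunLike.congr_fun (mfderiv_extChartAt_comp_mfderivWithin_extChartAt_symm hu) (Yh u)
  -- The points `z` and `y'` are tied by equations rather than substituted, since the tangent spaces
  -- depend on them.
  have hspace : ∀ t, ∀ u ∈ e.target, ∀ y' ∈ e.source, ∀ z, e.symm u = z → ψ t z = y' →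
      fderiv ℝ Ψ (t, u) (0, Xh u) = mfderiv I 𝓘(ℝ, E) e y' (mfderiv I I (ψ t) z (X z)) := by
    rintro t u hu _ hy' _ rfl rfl
    have hy'' : ψ t (e.symm u) ∈ (chartAt H y).source := by
      rwa [he, extChartAt_source] at hy'
    have h1 := (mdifferentiableAt_extChartAt (I := I) hy'').hasMFDerivAt.comp u
      ((((hψx t).mdifferentiableAt (by simp) (x := e.symm u)).hasMFDerivAt).comp u
        (hasMFDerivAt_extChartAt_symm hu))
    have h2 : HasFDerivAt (fun w => Ψ (t, w))
        ((fderiv ℝ Ψ (t, u)).comp (ContinuousLinearMap.inr ℝ ℝ E)) u :=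
      HasFDerivAt.comp u ((hΨ t u hu hy').differentiableAt (by simp)).hasFDerivAt
        (hasFDerivAt_prodMk_right t u)
    have h3 := DFunLike.congr_fun (h2.unique h1.hasFDerivAt) (Xh u)
    refine h3.trans ?_
    rw [← mfderivWithin_extChartAt_symm_mpullbackWithin X y hu]
    rfl
  have hu₀ : e y ∈ e.target := mem_extChartAt_target y
  have hc : HasDerivAt c (-(Yh (e y))) 0 := by
    have h1 := hasDerivAt_extChartAt_comp (y := y) (mem_extChartAt_source y) (hzero y)
      ((hψt y).mdifferentiableAt (by simp))
    have hYy : Yh (e y) = Y y := by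
      have h := mfderivWithin_extChartAt_symm_mpullbackWithin Y y hu₀
      rw [mfderivWithin_range_extChartAt_symm] at h
      have h' : ∀ x, x = y → (Y x : E) = Y y := by rintro _ rfl; rfl
      exact Eq.trans h (h' _ (e.left_inv (mem_extChartAt_source y)))
    rw [hY, mfderiv_extChartAt_self] at h1
    rw [hYy]
    have h2 : HasDerivAt (fun t => e (ψ t y)) (Y y : E) (-0) := by
      rw [neg_zero]; exact h1
    exact (h2.scomp (0 : ℝ) (hasDerivAt_neg (0 : ℝ))).congr_deriv (neg_one_smul ℝ (Y y : E))
  have hc0 : c 0 = e y := by simp [c, hzero]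
  have key := hasDerivAt_fderiv_apply_eq_neg_lieBracket (Ψ := Ψ) (u₀ := e y) (Y := Yh) (X := Xh)
    (c := c) ((hΨ 0 _ hu₀ (by rw [hzero]; exact hmap hu₀)).of_le ENat.LEInfty.out)
    (by
      filter_upwards [extChartAt_target_mem_nhds (I := I) y] with u hu
      simp [Ψ, hzero, e.right_inv hu])
    (by
      filter_upwards [extChartAt_target_mem_nhds (I := I) y] with u hu using htime u hu)
    (hX.differentiableAt_mpullbackWithin_extChartAt_symm y) hc0 hc
  have hsrc : ∀ᶠ t : ℝ in 𝓝 0, ψ (-t) y ∈ e.source := by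
    have h1 : ContinuousAt (fun t : ℝ => ψ (-t) y) 0 :=
      ((hψt y).continuous.comp continuous_neg).continuousAt
    refine h1.eventually_mem ?_
    simpa only [neg_zero, hzero] using extChartAt_source_mem_nhds (I := I) y
  have hbr : (VectorField.mlieBracket I Y X y : E) = VectorField.lieBracket ℝ Yh Xh (e y) := by
    rw [← VectorField.mlieBracketWithin_univ, VectorField.mlieBracketWithin_apply,
      mfderiv_extChartAt_self]
    refine (DFunLike.congr_fun (ContinuousLinearMap.inverse_id (R := ℝ) (M := E)) _).trans ?_
    change VectorField.lieBracketWithin ℝ Yh Xh (_ ∩ Set.range I) (e y) = _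
    rw [I.range_eq_univ, Set.preimage_univ, Set.univ_inter, VectorField.lieBracketWithin_univ]
  rw [hbr]
  refine key.congr_of_eventuallyEq ?_
  filter_upwards [hsrc] with t ht
  have := hspace t (c t) (e.map_source ht) y (mem_extChartAt_source y) (ψ (-t) y)
    (e.left_inv ht) (hinv t y)
  rw [this, he, mfderiv_extChartAt_self]
  rfl

/-- The cocycle identity `ψ_{(t+s)*} = ψ_{t*} ψ_{s*}` reduces time `t` to time `0` at the base point
`ψ (-t) y`, as the differential of `ψ t` there is a fixed linear map. -/
theorem hasDerivAt_pushforward_flow_of_add {ψ : ℝ → N → N}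
    (hψ : ContMDiff (𝓘(ℝ, ℝ).prod I) I ∞ (fun p : ℝ × N => ψ p.1 p.2))
    (hzero : ∀ x, ψ 0 x = x) (hadd : ∀ s t x, ψ (s + t) x = ψ s (ψ t x)) {X Y : VField I N}
    (hX : IsSmoothVField X)
    (hY : ∀ x, mfderiv 𝓘(ℝ, ℝ) I (fun t => ψ t x) 0 (1 : ℝ) = Y x) (y : N) (t : ℝ) :
    HasDerivAt (F := E) (fun s => mfderiv I I (ψ s) (ψ (-s) y) (X (ψ (-s) y)))
      (-(mfderiv I I (ψ t) (ψ (-t) y) (VectorField.mlieBracket I Y X (ψ (-t) y)))) t := by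
  have hψx : ∀ t x, MDifferentiableAt I I (ψ t) x := fun t x =>
    (hψ.comp (contMDiff_const.prodMk contMDiff_id)).mdifferentiableAt (by simp)
  have hinv : ∀ t x, ψ t (ψ (-t) x) = x := fun t x => by rw [← hadd, add_neg_cancel, hzero]
  have hcocycle : ∀ s, (mfderiv I I (ψ (t + s)) (ψ (-(t + s)) y) (X (ψ (-(t + s)) y)) : E) =
      mfderiv I I (ψ t) (ψ (-t) y)
        (mfderiv I I (ψ s) (ψ (-s) (ψ (-t) y)) (X (ψ (-s) (ψ (-t) y)))) := by
    intro s
    have h : ∀ w z, ψ s w = z →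
        (mfderiv I I (ψ (t + s)) w (X w) : E) = mfderiv I I (ψ t) z (mfderiv I I (ψ s) w (X w)) := by
      rintro w _ rfl
      have hcomp : ψ (t + s) = ψ t ∘ ψ s := funext fun x => hadd t s x
      rw [hcomp, mfderiv_comp w (hψx t _) (hψx s w)]
      rfl
    have hw : ψ (-(t + s)) y = ψ (-s) (ψ (-t) y) := by rw [← hadd]; congr 1; ring
    rw [hw]
    exact h _ _ (hinv s _)
  let T : E →L[ℝ] E := mfderiv I I (ψ t) (ψ (-t) y)
  have h0 := hasDerivAt_pushforward_flow hψ hzero hinv hX hY (ψ (-t) y)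
  have h1 := T.hasFDerivAt.comp_hasDerivAt (0 : ℝ) h0
  let F : ℝ → E := fun s => mfderiv I I (ψ s) (ψ (-s) y) (X (ψ (-s) y))
  have h2 : HasDerivAt (fun s => F (t + s)) (-(T (VectorField.mlieBracket I Y X (ψ (-t) y)))) 0 :=
    (h1.congr_of_eventuallyEq (Filter.Eventually.of_forall hcocycle)).congr_deriv
      (T.map_neg (VectorField.mlieBracket I Y X (ψ (-t) y) : E))
  have h3 := HasDerivAt.comp_sub_const t t (by rw [sub_self]; exact h2)
  simp only [add_sub_cancel] at h3
  exact h3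

theorem pushforward_flow_mem {ψ : ℝ → N → N}
    (hψ : ContMDiff (𝓘(ℝ, ℝ).prod I) I ∞ (fun p : ℝ × N => ψ p.1 p.2))
    (hzero : ∀ x, ψ 0 x = x) (hadd : ∀ s t x, ψ (s + t) x = ψ s (ψ t x)) {X Y : VField I N}
    (hY : ∀ x, mfderiv 𝓘(ℝ, ℝ) I (fun t => ψ t x) 0 (1 : ℝ) = Y x)
    {V : Submodule ℝ (VField I N)} [FiniteDimensional ℝ V] (hV : ∀ Z ∈ V, IsSmoothVField Z)
    (hYV : ∀ Z ∈ V, VectorField.mlieBracket I Y Z ∈ V) (hX : X ∈ V) (t : ℝ)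
    {Z : VField I N}
    (hZ : ∀ x, (Z x : E) = mfderiv I I (ψ t) (ψ (-t) x) (X (ψ (-t) x))) : Z ∈ V := by
  have hVd : ∀ Z ∈ V, ∀ x, MDifferentiableAt I I.tangent
      (fun x => (⟨x, Z x⟩ : TangentBundle I N)) x := fun Z hZ x =>
    (hV Z hZ).mdifferentiableAt (by simp)
  let ad : V →ₗ[ℝ] V :=
    { toFun := fun Z => ⟨VectorField.mlieBracket I Y Z.1, hYV Z.1 Z.2⟩
      map_add' := fun Z₁ Z₂ => Subtype.ext <| funext fun x =>
        VectorField.mlieBracket_add_right (hVd _ Z₁.2 x) (hVd _ Z₂.2 x)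
      map_smul' := fun r Z => Subtype.ext <| funext fun x =>
        VectorField.mlieBracket_const_smul_right (hVd _ Z.2 x) }
  let b := Module.finBasis ℝ V
  let coord := b.equivFun
  -- The value is prescribed at time `t`, not `0`, so that `c 0` is the sought element of `V`.
  obtain ⟨c, hc, hc'⟩ := exists_hasDerivAt_linear
    (coord.toLinearMap ∘ₗ ad ∘ₗ coord.symm.toLinearMap) t (coord ⟨X, hX⟩)
  let P : ℝ → (x : N) → V →ₗ[ℝ] E := fun s x =>
    (mfderiv I I (ψ s) (ψ (-s) x)).toLinearMap ∘ₗ (LinearMap.proj (ψ (-s) x)) ∘ₗ V.subtype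
  have hP : ∀ (Z : V) x s, HasDerivAt (fun s => P s x Z) (-(P s x (ad Z))) s := fun Z x s =>
    hasDerivAt_pushforward_flow_of_add hψ hzero hadd (hV Z.1 Z.2) hY x s
  have hF : ∀ x s, HasDerivAt (fun s => P s x (coord.symm (c s))) 0 s := by
    intro x s
    have h1 : ∀ v : Fin _ → ℝ, ∀ s, P s x (coord.symm v) = ∑ i, v i • P s x (b i) := by
      intro v s
      simp [coord, Module.Basis.equivFun_symm_apply]
    have h2 : HasDerivAt (fun s => ∑ i, c s i • P s x (b i))
        (∑ i, (c s i • (-(P s x (ad (b i)))) +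
          (coord (ad (coord.symm (c s)))) i • P s x (b i))) s :=
      HasDerivAt.fun_sum fun i _ =>
        HasDerivAt.fun_smul (hasDerivAt_pi.1 (hc' s) i) (hP (b i) x s)
    -- The moving frame contributes `-P (ad c)` and the coefficients `+P (ad c)`.
    have h3 : ∑ i, (c s i • (-(P s x (ad (b i)))) +
          (coord (ad (coord.symm (c s)))) i • P s x (b i)) = 0 := by
      rw [Finset.sum_add_distrib, ← h1, LinearEquiv.symm_apply_apply]
      have h4 : coord.symm (c s) = ∑ i, c s i • b i := Module.Basis.equivFun_symm_apply ..
      rw [h4]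
      simp
    rw [h3] at h2
    exact h2.congr_of_eventuallyEq (Filter.Eventually.of_forall fun s => h1 (c s) s)
  have hconst : ∀ x, P t x (coord.symm (c t)) = P 0 x (coord.symm (c 0)) := fun x =>
    is_const_of_deriv_eq_zero (fun s => (hF x s).differentiableAt) (fun s => (hF x s).deriv) t 0
  have hψ0 : ψ 0 = id := funext hzero
  have hZV : Z = (coord.symm (c 0) : V) := by
    funext x
    have h := hconst x
    rw [hc, LinearEquiv.symm_apply_apply] at h
    refine (hZ x).trans (h.trans ?_)
    have hw : ∀ w, w = x →
        (mfderiv I I (ψ 0) w ((coord.symm (c 0) : V).1 w) : E) = (coord.symm (c 0) : V).1 x := by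
      rintro _ rfl
      rw [hψ0, mfderiv_id]
      rfl
    exact hw _ (by rw [neg_zero, hzero])
  rw [hZV]
  exact (coord.symm (c 0)).2

end

/-! ### The action: velocity and smoothness of the transformed field. -/

section
variable {E H N : Type*} [NormedAddCommGroup E] [NormedSpace ℝ E]
    [TopologicalSpace H] {I : ModelWithCorners ℝ E H}
    [TopologicalSpace N] [ChartedSpace H N]
    {EG HG G : Type*} [NormedAddCommGroup EG] [NormedSpace ℝ EG]
    [TopologicalSpace HG] {IG : ModelWithCorners ℝ EG HG}
    [TopologicalSpace G] [ChartedSpace HG G] [Group G]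
    [MulAction G N] [ContMDiffSMul IG I ∞ G N]

theorem contMDiff_smul_const (x : N) : ContMDiff IG I ∞ (fun g : G => g • x) := by
  have h : ContMDiff IG IG ∞ (fun g : G => g) := contMDiff_id
  exact h.smul contMDiff_const

theorem contMDiff_smul_uncurry : ContMDiff (IG.prod I) I ∞ (fun p : G × N => p.1 • p.2) :=
  ContMDiffSMul.contMDiff_smul

theorem mfderiv_smul_eq_fundamentalVField {γ : ℝ → G} {t : ℝ}
    (hγ : MDifferentiableAt 𝓘(ℝ, ℝ) IG γ t) (h1 : γ t = 1) (x : N) :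
    (mfderiv 𝓘(ℝ, ℝ) I (fun s => γ s • x) t (1 : ℝ) : E) =
      fundamentalVField IG I N (G := G)
        (mfderiv 𝓘(ℝ, ℝ) IG γ t (1 : ℝ) : EG) x := by
  have hd : MDifferentiableAt IG I (fun g : G => g • x) (γ t) :=
    (contMDiff_smul_const x).mdifferentiableAt (by simp)
  have h : ∀ g, g = γ t → ∀ v : EG, (mfderiv IG I (fun g : G => g • x) (γ t) v : E) =
      (mfderiv IG I (fun g : G => g • x) g v : E) := by rintro _ rfl v; rfl
  have hc := mfderiv_comp t hd hγ
  refine (DFunLike.congr_fun hc (1 : ℝ)).trans ?_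
  exact h 1 h1.symm _

/-- The two summands are the partial differentials of the action map, in the `G` and `N` directions.
-/
theorem starVField_smul_eq_mfderiv {g : ℝ → G} {X : ℝ → VField I N} {t : ℝ}
    (hg : MDifferentiableAt 𝓘(ℝ, ℝ) IG g t) (x : N) :
    (starVField (fun s => (MulAction.toPerm (g s) : Equiv.Perm N)) X t x : E) =
      mfderiv (IG.prod I) I (fun p : G × N => p.1 • p.2) (g t, (g t)⁻¹ • x)
        ((mfderiv 𝓘(ℝ, ℝ) IG g t (1 : ℝ) : EG), (X t ((g t)⁻¹ • x) : E)) := by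
  set z := (g t)⁻¹ • x
  have hd : MDifferentiableAt (IG.prod I) I (fun p : G × N => p.1 • p.2) (g t, z) :=
    contMDiff_smul_uncurry.mdifferentiableAt (by simp)
  have hd1 : MDifferentiableAt IG I (fun h : G => h • z) (g t) :=
    (contMDiff_smul_const z).mdifferentiableAt (by simp)
  have hc := DFunLike.congr_fun (mfderiv_comp t hd1 hg) (1 : ℝ)
  refine (congrArg₂ (fun a b : E => a + b) hc rfl).trans ?_
  let v : EG × E := (mfderiv 𝓘(ℝ, ℝ) IG g t (1 : ℝ), X t z)
  exact (mfderiv_prod_eq_add_apply hd (v := v)).symm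

variable [LieGroup IG ∞ G]

theorem velocityVField_smul_mem {W : Submodule ℝ (VField I N)} (hΦ : IsAssociatedAction IG G W)
    {g : ℝ → G} {t : ℝ} (hg : MDifferentiableAt 𝓘(ℝ, ℝ) IG g t) :
    velocityVField I (fun s => (MulAction.toPerm (g s) : Equiv.Perm N)) t ∈ W := by
  have hγ : MDifferentiableAt 𝓘(ℝ, ℝ) IG (fun s => g s * (g t)⁻¹) t :=
    ((contMDiff_mul_right (I := IG) (n := ∞) (a := (g t)⁻¹)).mdifferentiableAt (by simp)).comp t hg
  have h := hΦ.mapsTo (Set.mem_univ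
    (mfderiv 𝓘(ℝ, ℝ) IG (fun s => g s * (g t)⁻¹) t (1 : ℝ) : EG))
  convert! h using 1
  funext x
  rw [← mfderiv_smul_eq_fundamentalVField hγ (mul_inv_cancel _) x]
  have hf : ∀ f f' : ℝ → N, f = f' → (mfderiv 𝓘(ℝ, ℝ) I f t (1 : ℝ) : E) =
      mfderiv 𝓘(ℝ, ℝ) I f' t (1 : ℝ) := by rintro _ _ rfl; rfl
  exact hf _ _ (funext fun s => (mul_smul _ _ _).symm)

variable [IsManifold I ∞ N]

theorem isSmoothTimeVField_starVField_smul {J : Set ℝ} (hJ : IsOpen J) {g : ℝ → G}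
    (hg : ContMDiffOn 𝓘(ℝ, ℝ) IG ∞ g J) {X : ℝ → VField I N} (hX : IsSmoothTimeVField J X) :
    IsSmoothTimeVField J (starVField (fun s => (MulAction.toPerm (g s) : Equiv.Perm N)) X) := by
  have hgJ : ContMDiffOn (𝓘(ℝ, ℝ).prod I) IG ∞ (fun p : ℝ × N => g p.1) (J ×ˢ Set.univ) :=
    hg.comp contMDiffOn_fst fun p hp => hp.1
  have hz : ContMDiffOn (𝓘(ℝ, ℝ).prod I) I ∞ (fun p : ℝ × N => (g p.1)⁻¹ • p.2) (J ×ˢ Set.univ) :=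
    hgJ.inv.smul contMDiffOn_snd
  have hXz : ContMDiffOn (𝓘(ℝ, ℝ).prod I) I.tangent ∞
      (fun p : ℝ × N => (⟨(g p.1)⁻¹ • p.2, X p.1 ((g p.1)⁻¹ • p.2)⟩ : TangentBundle I N))
      (J ×ˢ Set.univ) :=
    ContMDiffOn.comp hX (contMDiffOn_fst.prodMk hz) fun p hp => ⟨hp.1, trivial⟩
  have hdg : ContMDiffOn 𝓘(ℝ, ℝ) IG.tangent ∞
      (fun t => (⟨g t, mfderiv 𝓘(ℝ, ℝ) IG g t (1 : ℝ)⟩ : TangentBundle IG G)) J := by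
    have h1 := hg.contMDiffOn_tangentMapWithin (m := ∞) (by simp) hJ.uniqueMDiffOn
    -- The tangent map of `g` on the constant unit field of `ℝ` is the velocity of `g`.
    have h2 : ContMDiff 𝓘(ℝ, ℝ) 𝓘(ℝ, ℝ).tangent ∞
        (fun t : ℝ => (⟨t, (1 : ℝ)⟩ : TangentBundle 𝓘(ℝ, ℝ) ℝ)) := by
      exact fun t => contMDiffAt_vectorSpace_iff_contDiffAt.2 (contDiffAt_const (c := (1 : ℝ)))
    have h3 := h1.comp h2.contMDiffOn (s := J) fun t ht => ht
    refine h3.congr fun t ht => ?_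
    simp only [Function.comp, tangentMapWithin, mfderivWithin_of_isOpen hJ ht]
  have hdgJ : ContMDiffOn (𝓘(ℝ, ℝ).prod I) IG.tangent ∞
      (fun p : ℝ × N => (⟨g p.1, mfderiv 𝓘(ℝ, ℝ) IG g p.1 (1 : ℝ)⟩ : TangentBundle IG G))
      (J ×ˢ Set.univ) := hdg.comp contMDiffOn_fst fun p hp => hp.1
  have hpair := (contMDiff_equivTangentBundleProd_symm (I := IG) (M := G) (I' := I)
    (M' := N) (n := ∞)).comp_contMDiffOn (hdgJ.prodMk hXz)
  have hΦ := (contMDiff_smul_uncurry (IG := IG) (I := I) (G := G) (N := N)).contMDiff_tangentMap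
    (m := ∞) (by simp)
  refine (hΦ.comp_contMDiffOn hpair).congr fun p hp => ?_
  have hgt : MDifferentiableAt 𝓘(ℝ, ℝ) IG g p.1 :=
    (hg.contMDiffAt (hJ.mem_nhds hp.1)).mdifferentiableAt (by simp)
  have hstar := starVField_smul_eq_mfderiv (X := X) hgt p.2
  have hext : ∀ y z : N, ∀ v : E, ∀ w : E, y = z → v = w →
      (⟨y, v⟩ : TangentBundle I N) = ⟨z, w⟩ := by rintro _ _ _ _ rfl rfl; rfl
  exact hext _ _ _ _ (smul_inv_smul _ _).symm hstar

end

theorem lemma1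
    {E H N : Type*} [NormedAddCommGroup E] [NormedSpace ℝ E] [FiniteDimensional ℝ E]
    [TopologicalSpace H] (I : ModelWithCorners ℝ E H) [I.Boundaryless]
    [TopologicalSpace N] [T2Space N] [ChartedSpace H N] [IsManifold I ∞ N]
    (S : QuasiLieScheme I N) (hW : ∀ Y ∈ S.W, IsCompleteVField Y)
    {EG HG G : Type*} [NormedAddCommGroup EG] [NormedSpace ℝ EG] [FiniteDimensional ℝ EG]
    [TopologicalSpace HG] (IG : ModelWithCorners ℝ EG HG) [IG.Boundaryless]
    [TopologicalSpace G] [ChartedSpace HG G] [Group G] [LieGroup IG ∞ G]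
    [MulAction G N] [ContMDiffSMul IG I ∞ G N] (hΦ : IsAssociatedAction IG G S.W) :
    (∀ g ∈ lieExpSet IG G, ∀ X ∈ S.V,
      pushforwardVField (MulAction.toPerm g : Equiv.Perm N) X ∈ S.V) ∧
    (∀ J : Set ℝ, IsOpen J → ∀ g : ℝ → G, ContMDiffOn 𝓘(ℝ, ℝ) IG ∞ g J →
      (∀ t ∈ J, g t ∈ lieExpSet IG G) → ∀ X : ℝ → VField I N, S.Mem J X →
        S.Mem J (starVField (fun t => (MulAction.toPerm (g t) : Equiv.Perm N)) X)) := by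
  have push : ∀ g ∈ lieExpSet IG G, ∀ X ∈ S.V,
      pushforwardVField (MulAction.toPerm g : Equiv.Perm N) X ∈ S.V := by
    rintro _ ⟨a, γ, hγ, hγ0, hγadd, hγa, rfl⟩ X hX
    have : FiniteDimensional ℝ S.V := S.finiteDimensional_V
    have hψ : ContMDiff (𝓘(ℝ, ℝ).prod I) I ∞ (fun p : ℝ × N => γ p.1 • p.2) :=
      (hγ.comp contMDiff_fst).smul contMDiff_snd
    have hinv : γ (-1) = (γ 1)⁻¹ := by
      rw [eq_inv_iff_mul_eq_one, ← hγadd, neg_add_cancel, hγ0]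
    refine pushforward_flow_mem (ψ := fun t x => γ t • x) hψ (fun x => by rw [hγ0, one_smul])
      (fun s t x => by rw [hγadd, mul_smul])
      (Y := fundamentalVField IG I N (G := G) (mfderiv 𝓘(ℝ, ℝ) IG γ 0 (1 : ℝ) : EG))
      (fun x => mfderiv_smul_eq_fundamentalVField (hγ.mdifferentiableAt (by simp)) hγ0 x)
      S.smooth_V (S.bracket_W_V _ (hΦ.mapsTo (Set.mem_univ _))) hX 1 fun x => ?_
    rw [hinv]
    rfl
  refine ⟨push, fun J hJ g hg hgexp X hX =>
    ⟨isSmoothTimeVField_starVField_smul hJ hg hX.1, fun t ht => ?_⟩⟩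
  exact S.V.add_mem
    (S.W_le_V (velocityVField_smul_mem hΦ
      ((hg.contMDiffAt (hJ.mem_nhds ht)).mdifferentiableAt (by simp))))
    (push _ (hgexp t ht) _ (hX.2 t ht))
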